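/- Let $\mathcal H_X,\mathcal H_A$ be finite-dimensional complex Hilbert spaces, and write $\mathcal D(\mathcal H)$ for the set of density operators on $\mathcal H$ and $\langle M,N\rangle=\mathrm{Tr}(MN)$ for Hermitian $M,N$. Let $\mathcal N$ be a quantum channel (completely positive trace-preserving linear map) from operators on $\mathcal H_X\otimes\mathcal H_A$ to operators on $\mathcal H_X$, with Hilbert–Schmidt adjoint $\mathcal N^\dagger$, let $c$ be a Hermitian operator on $\mathcal H_X\otimes\mathcal H_A$, and let $\beta\in(0,1)$. An open-loop policy is a sequence $\gamma=(\gamma_t)_{t\ge 0}$ of quantum channels from $\mathcal H_X$ to $\mathcal H_X\otimes\mathcal H_A$ with $\mathrm{Tr}_A(\gamma_t(\rho))=\rho$ for all $t$ and all $\rho\in\mathcal D(\mathcal H_X)$. From an initial state $\rho_0\in\mathcal D(\mathcal H_X)$ it generates $\sigma_t=\gamma_t(\rho_t)$, $\rho_{t+1}=\mathcal N(\sigma_t)$ for $t\ge 0$, and has discounted cost $V(\gamma,\rho_0)=\sum_{t\ge0}\beta^t\langle c,\sigma_t\rangle$. Let $V^*(\rho_0)=\inf_\gamma V(\gamma,\rho_0)$,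 the infimum over all open-loop policies; $\gamma$ is optimal for $\rho_0$ (among open-loop policies) if $V(\gamma,\rho_0)=V^*(\rho_0)$. Assume that there is a Hermitian operator $\xi^*$ on $\mathcal H_X$ such that $$c+\beta\,\mathcal N^\dagger(\xi^*)\succcurlyeq \xi^*\otimes \mathrm{Id} \quad\text{and}\quad \min_{\pi\in\mathcal D(\mathcal H_A)}\langle c+\beta\,\mathcal N^\dagger(\xi^*),\rho\otimes\pi\rangle=\langle\xi^*,\rho\rangle\ \text{ for all }\rho\in\mathcal D(\mathcal H_X).$$ Then for every $\rho_0\in\mathcal D(\mathcal H_X)$: 1. $V^*(\rho_0)=\langle\xi^*,\rho_0\rangle$; in particular the optimal value function is linear. 2. There is $\pi^*\in\mathcal D(\mathcal H_A)$ such that the stationary open-loop policy with $\gamma_t(\rho)=\rho\otimes\pi^*$ for all $t$ and $\rho$ is optimal for $\rho_0$. -/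

import Mathlib

open scoped Matrix Kronecker ComplexOrder

noncomputable section

/-! ### Finite dimensional quantum systems

A finite dimensional Hilbert space with a fixed orthonormal basis indexed by a finite type `n` is
represented by its index type; operators on it are complex `n × n` matrices, and the tensor product
of the spaces indexed by `X` and `A` is indexed by `X × A`. -/

/-- Density operators: positive semidefinite with unit trace. -/
def IsDensity {n : Type*} [Fintype n] (ρ : Matrix n n ℂ) : Prop :=
  ρ.PosSemidef ∧ ρ.trace = 1

/-- The set of density operators, as a type. -/
abbrev DensityOp (n : Type*) [Fintype n] : Type _ :=
  {ρ : Matrix n n ℂ // IsDensity ρ}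

/-- The Hilbert-Schmidt pairing `⟨M, N⟩ = Tr (M N)` of Hermitian operators; for Hermitian `M` and
`N` the trace is real, so that taking the real part only changes the type. -/
def hsInner {n : Type*} [Fintype n] (M N : Matrix n n ℂ) : ℝ :=
  (M * N).trace.re

/-- Super-operators: linear maps from operators to operators. -/
abbrev SuperOp (m n : Type*) : Type _ := Matrix m m ℂ →ₗ[ℂ] Matrix n n ℂ

/-- The super-operator `Φ ⊗ Id` on the composite with an environment indexed by `e`: it applies `Φ`
to each block `(M (·, a) (·, b))` of `M`. -/
def ampliation {m n : Type*} (Φ : SuperOp m n) (e : Type*) (M : Matrix (m × e) (m × e) ℂ) :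
    Matrix (n × e) (n × e) ℂ :=
  Matrix.of fun p q => Φ (Matrix.of fun i j => M (i, p.2) (j, q.2)) p.1 q.1

/-- Complete positivity: `Φ ⊗ Id` is positive for every finite dimensional environment. -/
def IsCompletelyPositive {m n : Type*} (Φ : SuperOp m n) : Prop :=
  ∀ (k : ℕ) (M : Matrix (m × Fin k) (m × Fin k) ℂ),
    M.PosSemidef → (ampliation Φ (Fin k) M).PosSemidef

/-- Quantum channels: completely positive, trace preserving super-operators. -/
def IsChannel {m n : Type*} [Fintype m] [Fintype n] (Φ : SuperOp m n) : Prop :=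
  IsCompletelyPositive Φ ∧ ∀ M, (Φ M).trace = M.trace

/-- The Hilbert-Schmidt adjoint `Φ†`; the entry at `(i, j)` is `⟨Φ |i⟩⟨j|, Y⟩`. -/
def hsAdjoint {m n : Type*} [DecidableEq m] [Fintype n] (Φ : SuperOp m n) (Y : Matrix n n ℂ) :
    Matrix m m ℂ :=
  Matrix.of fun i j => ((Φ (Matrix.single i j 1))ᴴ * Y).trace

/-- The defining property of the adjoint, for the inner product `⟨M, N⟩ = Tr (Mᴴ N)`. -/
theorem trace_conjTranspose_mul_hsAdjoint {m n : Type*} [Fintype m] [DecidableEq m] [Fintype n]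
    (Φ : SuperOp m n) (M : Matrix m m ℂ) (Y : Matrix n n ℂ) :
    (Mᴴ * hsAdjoint Φ Y).trace = ((Φ M)ᴴ * Y).trace := by
  have hM : Φ M = ∑ i, ∑ j, M i j • Φ (Matrix.single i j 1) := by
    conv_lhs => rw [Matrix.matrix_eq_sum_single M]
    simp only [map_sum]
    refine Finset.sum_congr rfl fun i _ => Finset.sum_congr rfl fun j _ => ?_
    rw [← map_smul, Matrix.smul_single, smul_eq_mul, mul_one]
  rw [hM]
  simp only [Matrix.conjTranspose_sum, Matrix.conjTranspose_smul, Finset.sum_mul,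
    Matrix.trace_sum, Matrix.smul_mul, Matrix.trace_smul]
  simp only [Matrix.trace, Matrix.diag_apply, Matrix.mul_apply, Matrix.conjTranspose_apply,
    hsAdjoint, Matrix.of_apply, smul_eq_mul]
  rw [Finset.sum_comm]

/-- The partial trace over the second factor. -/
def partialTrace {X A : Type*} [Fintype A] (σ : Matrix (X × A) (X × A) ℂ) : Matrix X X ℂ :=
  Matrix.of fun x y => ∑ a, σ (x, a) (y, a)

/-- The appending super-operator `ρ ↦ ρ ⊗ π`. -/
def appendOp {X A : Type*} (π : Matrix A A ℂ) : SuperOp X (X × A) where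
  toFun ρ := ρ ⊗ₖ π
  map_add' ρ ρ' := Matrix.add_kronecker ρ ρ' π
  map_smul' r ρ := Matrix.smul_kronecker r ρ π

/-! ### Quantum Markov decision processes -/

/-- A discounted quantum Markov decision process on finite dimensional state space `X` and action
space `A`: the state transition channel, the Hermitian one-stage cost and the discount factor. -/
structure QMDP (X A : Type*) [Fintype X] [Fintype A] where
  transition : SuperOp (X × A) X
  isChannel_transition : IsChannel transition
  cost : Matrix (X × A) (X × A) ℂ
  isHermitian_cost : cost.IsHermitian
  discount : ℝ
  discount_pos : 0 < discount
  discount_lt_one : discount < 1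

/-- An open-loop policy: a sequence of quantum channels from states to state-action operators, each
of which is inverted by the partial trace over the action space. -/
structure OpenLoopPolicy (X A : Type*) [Fintype X] [Fintype A] where
  channel : ℕ → SuperOp X (X × A)
  isChannel : ∀ t, IsChannel (channel t)
  partialTrace_channel : ∀ t ρ, IsDensity ρ → partialTrace (channel t ρ) = ρ

/-- A policy is stationary if it uses the same channel at all times. -/
def OpenLoopPolicy.IsStationary {X A : Type*} [Fintype X] [Fintype A]
    (γ : OpenLoopPolicy X A) : Prop :=
  ∀ s t, γ.channel s = γ.channel t

namespace QMDP

variable {X A : Type*} [Fintype X] [Fintype A]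

/-- The state `ρ_t` under the policy `γ` from the initial state `ρ₀`. -/
def state (Q : QMDP X A) (γ : OpenLoopPolicy X A) (ρ₀ : DensityOp X) : ℕ → Matrix X X ℂ
  | 0 => ρ₀.1
  | t + 1 => Q.transition (γ.channel t (state Q γ ρ₀ t))

/-- The action `σ_t = γ_t(ρ_t)`. -/
def action (Q : QMDP X A) (γ : OpenLoopPolicy X A) (ρ₀ : DensityOp X) (t : ℕ) :
    Matrix (X × A) (X × A) ℂ :=
  γ.channel t (Q.state γ ρ₀ t)

/-- The discounted cost `V(γ, ρ₀) = ∑ t, β ^ t ⟨c, σ_t⟩`. -/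
def value (Q : QMDP X A) (γ : OpenLoopPolicy X A) (ρ₀ : DensityOp X) : ℝ :=
  ∑' t, Q.discount ^ t * hsInner Q.cost (Q.action γ ρ₀ t)

/-- The optimal value `V*(ρ₀)` over open-loop policies. -/
def optimalValue (Q : QMDP X A) (ρ₀ : DensityOp X) : ℝ :=
  ⨅ γ : OpenLoopPolicy X A, Q.value γ ρ₀

/-- The policy `γ` is optimal for `ρ₀` among open-loop policies. -/
def IsOptimal (Q : QMDP X A) (γ : OpenLoopPolicy X A) (ρ₀ : DensityOp X) : Prop :=
  Q.value γ ρ₀ = Q.optimalValue ρ₀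

/-- Feasibility for the dual semidefinite program: `ξ` is Hermitian and
`c + β N†(ξ) ≽ ξ ⊗ Id`. -/
def DualFeasible [DecidableEq X] [DecidableEq A] (Q : QMDP X A) (ξ : Matrix X X ℂ) : Prop :=
  ξ.IsHermitian ∧
    (Q.cost + (Q.discount : ℂ) • hsAdjoint Q.transition ξ -
      ξ ⊗ₖ (1 : Matrix A A ℂ)).PosSemidef

/-- Tightness of the Bellman inequality: for every density operator `ρ`, the minimum over density
operators `π` of `⟨c + β N†(ξ), ρ ⊗ π⟩` exists and equals `⟨ξ, ρ⟩`. -/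
def BellmanTight [DecidableEq X] [DecidableEq A] (Q : QMDP X A) (ξ : Matrix X X ℂ) : Prop :=
  ∀ ρ : DensityOp X,
    IsLeast
      (Set.range fun π : DensityOp A =>
        hsInner (Q.cost + (Q.discount : ℂ) • hsAdjoint Q.transition ξ) (ρ.1 ⊗ₖ π.1))
      (hsInner ξ ρ.1)

end QMDP

/-! ### The discounted cost series converges and the costs are bounded below -/

theorem IsDensity.norm_apply_le_one {n : Type*} [Fintype n] {ρ : Matrix n n ℂ}
    (h : IsDensity ρ) (i j : n) : ‖ρ i j‖ ≤ 1 := by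
  have hd : ∀ k, 0 ≤ ρ k k := fun k => h.1.diag_nonneg
  have hd1 : ∀ k, ρ k k ≤ 1 := fun k => by
    rw [← h.2]
    exact Finset.single_le_sum (f := fun k => ρ k k) (fun k _ => hd k) (Finset.mem_univ k)
  have hdet := (h.1.submatrix ![i, j]).det_nonneg
  rw [Matrix.det_fin_two] at hdet
  simp only [Matrix.submatrix_apply, Matrix.cons_val_zero, Matrix.cons_val_one] at hdet
  have hji : ρ j i = star (ρ i j) := (h.1.1.apply j i).symm
  rw [hji, ← starRingEnd_apply, Complex.mul_conj, Complex.normSq_eq_norm_sq] at hdet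
  have h2 : ρ i i * ρ j j ≤ 1 := mul_le_one₀ (hd1 i) (hd j) (hd1 j)
  have h3 : ((‖ρ i j‖ ^ 2 : ℝ) : ℂ) ≤ ((1 : ℝ) : ℂ) := by
    have := (sub_nonneg.1 hdet).trans h2
    simpa using this
  have h4 : ‖ρ i j‖ ^ 2 ≤ 1 := by exact_mod_cast h3
  nlinarith [norm_nonneg (ρ i j)]

theorem IsChannel.isDensity {m n : Type*} [Fintype m] [Fintype n] {Φ : SuperOp m n}
    (hΦ : IsChannel Φ) {ρ : Matrix m m ℂ} (h : IsDensity ρ) : IsDensity (Φ ρ) := by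
  refine ⟨?_, by rw [hΦ.2, h.2]⟩
  have := (hΦ.1 1 _ (h.1.submatrix (Prod.fst : m × Fin 1 → m))).submatrix
    (fun i : n => (i, (0 : Fin 1)))
  exact this

theorem QMDP.isDensity_state {X A : Type*} [Fintype X] [Fintype A] (Q : QMDP X A)
    (γ : OpenLoopPolicy X A) (ρ₀ : DensityOp X) (t : ℕ) : IsDensity (Q.state γ ρ₀ t) := by
  induction t with
  | zero => exact ρ₀.2
  | succ t ih => exact Q.isChannel_transition.isDensity ((γ.isChannel t).isDensity ih)

theorem QMDP.isDensity_action {X A : Type*} [Fintype X] [Fintype A] (Q : QMDP X A)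
    (γ : OpenLoopPolicy X A) (ρ₀ : DensityOp X) (t : ℕ) : IsDensity (Q.action γ ρ₀ t) :=
  (γ.isChannel t).isDensity (Q.isDensity_state γ ρ₀ t)

theorem abs_hsInner_le {n : Type*} [Fintype n] (c : Matrix n n ℂ) {σ : Matrix n n ℂ}
    (h : IsDensity σ) : |hsInner c σ| ≤ ∑ i, ∑ j, ‖c i j‖ := by
  refine (Complex.abs_re_le_norm _).trans ?_
  refine (norm_sum_le _ _).trans (Finset.sum_le_sum fun i _ => ?_)
  rw [Matrix.diag_apply, Matrix.mul_apply]
  refine (norm_sum_le _ _).trans (Finset.sum_le_sum fun j _ => ?_)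
  rw [norm_mul]
  exact mul_le_of_le_one_right (norm_nonneg _) (h.norm_apply_le_one j i)

theorem QMDP.summable_value {X A : Type*} [Fintype X] [Fintype A] (Q : QMDP X A)
    (γ : OpenLoopPolicy X A) (ρ₀ : DensityOp X) :
    Summable fun t => Q.discount ^ t * hsInner Q.cost (Q.action γ ρ₀ t) := by
  refine Summable.of_norm_bounded
    ((summable_geometric_of_lt_one Q.discount_pos.le Q.discount_lt_one).mul_right
      (∑ i, ∑ j, ‖Q.cost i j‖)) fun t => ?_
  rw [norm_mul, norm_pow, Real.norm_of_nonneg Q.discount_pos.le, Real.norm_eq_abs]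
  exact mul_le_mul_of_nonneg_left (abs_hsInner_le _ (Q.isDensity_action γ ρ₀ t))
    (pow_nonneg Q.discount_pos.le t)

theorem QMDP.bddBelow_value {X A : Type*} [Fintype X] [Fintype A] (Q : QMDP X A)
    (ρ₀ : DensityOp X) : BddBelow (Set.range fun γ : OpenLoopPolicy X A => Q.value γ ρ₀) := by
  refine ⟨∑' t, Q.discount ^ t * -(∑ i, ∑ j, ‖Q.cost i j‖), ?_⟩
  rintro _ ⟨γ, rfl⟩
  refine Summable.tsum_le_tsum (fun t => ?_)
    ((summable_geometric_of_lt_one Q.discount_pos.le Q.discount_lt_one).mul_right _)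
    (Q.summable_value γ ρ₀)
  exact mul_le_mul_of_nonneg_left
    (neg_le_of_abs_le (abs_hsInner_le _ (Q.isDensity_action γ ρ₀ t)))
    (pow_nonneg Q.discount_pos.le t)

end

/-! ### The trace pairing and positivity. -/

section Pairing

variable {n : Type*} [Fintype n]

/-! Let S = c + β N†(ξ) - ξ ⊗ Id. Along any policy, ⟨S, σ_t⟩ = ⟨c, σ_t⟩ + β⟨ξ, ρ_{t+1}⟩ - ⟨ξ, ρ_t⟩,
so the discounted sum telescopes to V(γ, ρ₀) - ⟨ξ, ρ₀⟩ (`QMDP.hasSum_slack`). As S ≽ 0, this excess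
is nonnegative. For equality, tightness at the maximally mixed state gives π with ⟨S, Id ⊗ π⟩ = 0.
Both factors are positive, so S (Id ⊗ π) = 0, hence S (ρ ⊗ π) = 0 for every ρ
(`QMDP.exists_slack_mul_kronecker_eq_zero`). Appending this one π at all times makes every slack
term vanish. -/

theorem hsInner_add_left (M M' N : Matrix n n ℂ) :
    hsInner (M + M') N = hsInner M N + hsInner M' N := by
  simp [hsInner, add_mul, Matrix.trace_add]

theorem hsInner_sub_left (M M' N : Matrix n n ℂ) :
    hsInner (M - M') N = hsInner M N - hsInner M' N := by
  simp [hsInner, sub_mul, Matrix.trace_sub]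

theorem hsInner_smul_left (r : ℝ) (M N : Matrix n n ℂ) :
    hsInner ((r : ℂ) • M) N = r * hsInner M N := by
  simp [hsInner, Matrix.smul_mul, Matrix.trace_smul]

theorem trace_conjTranspose_mul_self_mul (B C : Matrix n n ℂ) :
    ((Bᴴ * B) * (Cᴴ * C)).trace = ((B * Cᴴ)ᴴ * (B * Cᴴ)).trace := by
  rw [Matrix.conjTranspose_mul, Matrix.conjTranspose_conjTranspose, ← Matrix.mul_assoc,
    Matrix.trace_mul_comm]
  simp only [Matrix.mul_assoc]

open scoped MatrixOrder in
theorem Matrix.PosSemidef.exists_eq_conjTranspose_mul_self {M : Matrix n n ℂ}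
    (hM : M.PosSemidef) : ∃ B : Matrix n n ℂ, M = Bᴴ * B := by
  classical
  exact CStarAlgebra.nonneg_iff_eq_star_mul_self.1 hM.nonneg

/-- The trace of a product of positive semidefinite matrices is nonnegative. -/
theorem Matrix.PosSemidef.trace_mul_nonneg_of_posSemidef {M N : Matrix n n ℂ}
    (hM : M.PosSemidef) (hN : N.PosSemidef) : 0 ≤ (M * N).trace := by
  obtain ⟨B, rfl⟩ := hM.exists_eq_conjTranspose_mul_self
  obtain ⟨C, rfl⟩ := hN.exists_eq_conjTranspose_mul_self
  rw [trace_conjTranspose_mul_self_mul]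
  exact (Matrix.posSemidef_conjTranspose_mul_self _).trace_nonneg

/-- Positive semidefinite matrices that are orthogonal for the trace pairing have product zero. -/
theorem Matrix.PosSemidef.mul_eq_zero_of_trace_mul_eq_zero {M N : Matrix n n ℂ}
    (hM : M.PosSemidef) (hN : N.PosSemidef) (h : (M * N).trace = 0) : M * N = 0 := by
  obtain ⟨B, rfl⟩ := hM.exists_eq_conjTranspose_mul_self
  obtain ⟨C, rfl⟩ := hN.exists_eq_conjTranspose_mul_self
  -- The trace is the squared Hilbert-Schmidt norm of B Cᴴ, so B Cᴴ = 0, and this is the middle of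
  -- the product Bᴴ B Cᴴ C.
  rw [trace_conjTranspose_mul_self_mul,
    Matrix.trace_conjTranspose_mul_self_eq_zero_iff] at h
  rw [Matrix.mul_assoc, ← Matrix.mul_assoc B, h, Matrix.zero_mul, Matrix.mul_zero]

theorem hsInner_nonneg {M N : Matrix n n ℂ} (hM : M.PosSemidef) (hN : N.PosSemidef) :
    0 ≤ hsInner M N :=
  (Complex.nonneg_iff.1 (hM.trace_mul_nonneg_of_posSemidef hN)).1

/-- `hsInner` keeps only the real part, but the trace is nonnegative in the complex order, so its
imaginary part vanishes too. -/
theorem mul_eq_zero_of_hsInner_eq_zero {M N : Matrix n n ℂ} (hM : M.PosSemidef)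
    (hN : N.PosSemidef) (h : hsInner M N = 0) : M * N = 0 :=
  hM.mul_eq_zero_of_trace_mul_eq_zero hN <|
    Complex.ext h (Complex.nonneg_iff.1 (hM.trace_mul_nonneg_of_posSemidef hN)).2.symm

theorem hsInner_hsAdjoint {m : Type*} [Fintype m] [DecidableEq m] {Φ : SuperOp m n}
    (Y : Matrix n n ℂ) {σ : Matrix m m ℂ} (hσ : σ.IsHermitian) (hΦσ : (Φ σ).IsHermitian) :
    hsInner (hsAdjoint Φ Y) σ = hsInner Y (Φ σ) := by
  have h := trace_conjTranspose_mul_hsAdjoint Φ σ Y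
  rw [hσ.eq, hΦσ.eq] at h
  rw [hsInner, hsInner, Matrix.trace_mul_comm, h, Matrix.trace_mul_comm]

/-- The maximally mixed state. -/
theorem isDensity_card_inv_smul_one [DecidableEq n] [Nonempty n] :
    IsDensity (((Fintype.card n : ℝ)⁻¹ : ℂ) • (1 : Matrix n n ℂ)) := by
  refine ⟨Matrix.PosSemidef.one.smul ?_, ?_⟩
  · have : (0 : ℝ) ≤ (Fintype.card n : ℝ)⁻¹ := by positivity
    exact_mod_cast this
  · simp [Matrix.trace_smul, Matrix.trace_one]

theorem IsDensity.nonempty {ρ : Matrix n n ℂ} (h : IsDensity ρ) : Nonempty n := by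
  by_contra hn
  rw [not_nonempty_iff] at hn
  simpa [Matrix.trace] using h.2

end Pairing

/-! ### Product operators and the appending channel. -/

section Tensor

variable {X A : Type*} [Fintype A]

theorem hsInner_kronecker_one [Fintype X] [DecidableEq A] (ξ : Matrix X X ℂ) (σ : Matrix (X × A) (X × A) ℂ) :
    hsInner (ξ ⊗ₖ (1 : Matrix A A ℂ)) σ = hsInner ξ (partialTrace σ) := by
  unfold hsInner
  congr 1
  simp only [Matrix.trace, Matrix.diag_apply, Matrix.mul_apply, Fintype.sum_prod_type,
    Matrix.kronecker_apply, partialTrace, Matrix.of_apply, Matrix.one_apply, mul_ite, ite_mul,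
    mul_one, mul_zero, zero_mul, Finset.sum_ite_eq, Finset.mem_univ, if_true, Finset.mul_sum]
  exact Finset.sum_congr rfl fun i _ => Finset.sum_comm

theorem partialTrace_kronecker (ρ : Matrix X X ℂ) {π : Matrix A A ℂ} (hπ : IsDensity π) :
    partialTrace (ρ ⊗ₖ π) = ρ := by
  ext x y
  have h : ∑ a, π a a = 1 := hπ.2
  simp [partialTrace, ← Finset.mul_sum, h]

theorem isChannel_appendOp [Fintype X] {π : Matrix A A ℂ} (hπ : IsDensity π) :
    IsChannel (appendOp π : SuperOp X (X × A)) := by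
  refine ⟨fun k M hM => ?_, fun M => ?_⟩
  -- The ampliation sends M to M ⊗ π with the environment and action factors swapped.
  · exact (hM.kronecker hπ.1).submatrix
      (fun p : (X × A) × Fin k => ((p.1.1, p.2), p.1.2))
  · change (M ⊗ₖ π).trace = _
    rw [Matrix.trace_kronecker, hπ.2, mul_one]

/-- The stationary policy that prepares the action state `π` at all times. -/
def OpenLoopPolicy.append [Fintype X] (π : DensityOp A) : OpenLoopPolicy X A where
  channel _ := appendOp π.1
  isChannel _ := isChannel_appendOp π.2
  partialTrace_channel _ ρ _ := partialTrace_kronecker ρ π.2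

end Tensor

/-! ### Telescoping and complementary slackness. -/

namespace QMDP

variable {X A : Type*} [Fintype X] [DecidableEq X] [Fintype A] [DecidableEq A]

/-- The slack `c + β N†(ξ) - ξ ⊗ Id` in the dual constraint. -/
def slack (Q : QMDP X A) (ξ : Matrix X X ℂ) : Matrix (X × A) (X × A) ℂ :=
  Q.cost + (Q.discount : ℂ) • hsAdjoint Q.transition ξ - ξ ⊗ₖ (1 : Matrix A A ℂ)

/-- Moving N† across the pairing produces the next state; the partial trace condition on the policy
recovers the current one. -/
theorem hsInner_slack_action (Q : QMDP X A) (ξ : Matrix X X ℂ) (γ : OpenLoopPolicy X A)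
    (ρ₀ : DensityOp X) (t : ℕ) :
    hsInner (Q.slack ξ) (Q.action γ ρ₀ t) =
      hsInner Q.cost (Q.action γ ρ₀ t) + Q.discount * hsInner ξ (Q.state γ ρ₀ (t + 1)) -
        hsInner ξ (Q.state γ ρ₀ t) := by
  rw [slack, hsInner_sub_left, hsInner_add_left, hsInner_smul_left, hsInner_kronecker_one,
    hsInner_hsAdjoint ξ (Q.isDensity_action γ ρ₀ t).1.1 (Q.isDensity_state γ ρ₀ (t + 1)).1.1]
  rw [action, γ.partialTrace_channel t _ (Q.isDensity_state γ ρ₀ t)]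
  rfl

/-- The discounted slack along a policy sums to the excess of its cost over `⟨ξ, ρ₀⟩`. -/
theorem hasSum_slack (Q : QMDP X A) (ξ : Matrix X X ℂ) (γ : OpenLoopPolicy X A)
    (ρ₀ : DensityOp X) :
    HasSum (fun t => Q.discount ^ t * hsInner (Q.slack ξ) (Q.action γ ρ₀ t))
      (Q.value γ ρ₀ - hsInner ξ ρ₀.1) := by
  have hξ : Summable fun t => Q.discount ^ t * hsInner ξ (Q.state γ ρ₀ t) := by
    refine Summable.of_norm_bounded
      ((summable_geometric_of_lt_one Q.discount_pos.le Q.discount_lt_one).mul_right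
        (∑ i, ∑ j, ‖ξ i j‖)) fun t => ?_
    rw [norm_mul, norm_pow, Real.norm_of_nonneg Q.discount_pos.le, Real.norm_eq_abs]
    exact mul_le_mul_of_nonneg_left (abs_hsInner_le _ (Q.isDensity_state γ ρ₀ t))
      (pow_nonneg Q.discount_pos.le t)
  -- The shifted series lacks only its term at 0, so the difference of the two ξ-series is -⟨ξ, ρ₀⟩.
  have h := ((Q.summable_value γ ρ₀).hasSum.add ((hasSum_nat_add_iff' 1).2 hξ.hasSum)).sub
    hξ.hasSum
  have hterm (t : ℕ) : Q.discount ^ t * hsInner (Q.slack ξ) (Q.action γ ρ₀ t) =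
      Q.discount ^ t * hsInner Q.cost (Q.action γ ρ₀ t) +
        Q.discount ^ (t + 1) * hsInner ξ (Q.state γ ρ₀ (t + 1)) -
        Q.discount ^ t * hsInner ξ (Q.state γ ρ₀ t) := by
    rw [hsInner_slack_action]
    ring
  simp only [hterm]
  rwa [Finset.sum_range_one, pow_zero, one_mul, add_sub_assoc, sub_sub_cancel_left,
    ← sub_eq_add_neg] at h

theorem hsInner_le_value {Q : QMDP X A} {ξ : Matrix X X ℂ} (h : Q.DualFeasible ξ)
    (γ : OpenLoopPolicy X A) (ρ₀ : DensityOp X) : hsInner ξ ρ₀.1 ≤ Q.value γ ρ₀ :=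
  sub_nonneg.1 <| (Q.hasSum_slack ξ γ ρ₀).nonneg fun t =>
    mul_nonneg (pow_nonneg Q.discount_pos.le t)
      (hsInner_nonneg h.2 (Q.isDensity_action γ ρ₀ t).1)

/-- Complementary slackness: tightness at the maximally mixed state gives one action state that is
tight for all states. -/
theorem exists_slack_mul_kronecker_eq_zero [Nonempty X] {Q : QMDP X A} {ξ : Matrix X X ℂ}
    (hfeas : Q.DualFeasible ξ) (htight : Q.BellmanTight ξ) :
    ∃ π : DensityOp A, ∀ ρ : Matrix X X ℂ, Q.slack ξ * (ρ ⊗ₖ π.1) = 0 := by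
  obtain ⟨π, hπ⟩ := (htight ⟨_, isDensity_card_inv_smul_one⟩).1
  refine ⟨π, fun ρ => ?_⟩
  have hd : IsDensity (((Fintype.card X : ℝ)⁻¹ : ℂ) • (1 : Matrix X X ℂ)) :=
    isDensity_card_inv_smul_one
  have h0 : hsInner (Q.slack ξ) ((((Fintype.card X : ℝ)⁻¹ : ℂ) • (1 : Matrix X X ℂ)) ⊗ₖ π.1) =
      0 := by
    rw [slack, hsInner_sub_left, hsInner_kronecker_one, partialTrace_kronecker _ π.2]
    exact sub_eq_zero.2 hπ
  have h1 := mul_eq_zero_of_hsInner_eq_zero hfeas.2 (hd.1.kronecker π.2.1) h0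
  have hc : ((Fintype.card X : ℝ) : ℂ)⁻¹ ≠ 0 := by simp
  rw [Matrix.smul_kronecker, Matrix.mul_smul, smul_eq_zero_iff_right hc] at h1
  -- Factoring ρ ⊗ π = (Id ⊗ π)(ρ ⊗ Id) passes from the identity to arbitrary ρ.
  calc Q.slack ξ * (ρ ⊗ₖ π.1)
      = Q.slack ξ * ((1 : Matrix X X ℂ) ⊗ₖ π.1) * (ρ ⊗ₖ (1 : Matrix A A ℂ)) := by
        rw [Matrix.mul_assoc, ← Matrix.mul_kronecker_mul, Matrix.one_mul, Matrix.mul_one]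
    _ = 0 := by rw [slack, h1, Matrix.zero_mul]

end QMDP

theorem mainTheorem1 {X A : Type*} [Fintype X] [DecidableEq X] [Fintype A] [DecidableEq A]
    (Q : QMDP X A) (ξ : Matrix X X ℂ) (hfeas : Q.DualFeasible ξ) (htight : Q.BellmanTight ξ)
    (ρ₀ : DensityOp X) :
    Q.optimalValue ρ₀ = hsInner ξ ρ₀.1 ∧
      ∃ (π : DensityOp A) (γ : OpenLoopPolicy X A),
        γ.IsStationary ∧ (∀ t, γ.channel t = appendOp π.1) ∧ Q.IsOptimal γ ρ₀ := by
  have := ρ₀.2.nonempty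
  obtain ⟨π, hπ⟩ := QMDP.exists_slack_mul_kronecker_eq_zero hfeas htight
  let γ : OpenLoopPolicy X A := OpenLoopPolicy.append π
  have hγ : Q.value γ ρ₀ = hsInner ξ ρ₀.1 := by
    refine sub_eq_zero.1 ((Q.hasSum_slack ξ γ ρ₀).unique ?_)
    convert hasSum_zero using 2 with t
    have h : Q.slack ξ * Q.action γ ρ₀ t = 0 := hπ (Q.state γ ρ₀ t)
    simp [hsInner, h]
  -- Needed for the lower bound: a real infimum over an empty family would be 0.
  have : Nonempty (OpenLoopPolicy X A) := ⟨γ⟩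
  have hopt : Q.optimalValue ρ₀ = hsInner ξ ρ₀.1 :=
    le_antisymm ((ciInf_le (Q.bddBelow_value ρ₀) γ).trans_eq hγ)
      (le_ciInf fun γ' => QMDP.hsInner_le_value hfeas γ' ρ₀)
  exact ⟨hopt, π, γ, fun _ _ => rfl, fun _ => rfl, hγ.trans hopt.symm⟩
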